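/- There is a numerical constant $0<c<\infty$ such that the following holds. Let $P$ be a probability distribution on a measurable space $\mathcal Z$, let $\Theta$ be a set of model parameters, and let $\ell(\theta,\cdot):\mathcal Z\to[M_0,M_1]$ be measurable for each $\theta\in\Theta$; put $M=M_1-M_0$ and $R(\theta)=\mathbb E_{z\sim P}[\ell(\theta,z)]$. Let $\theta_*\in\operatorname{argmin}_{\theta\in\Theta}R(\theta)$, and let $\theta_{\mathrm{ref}}\in\Theta$ be a reference model from the same family. Assume that the class $\mathcal F_r=\{\ell(\theta,\cdot)-\ell(\theta_{\mathrm{ref}},\cdot):\theta\in\Theta\}$ has finite VC-dimension $d_v$, i.e. $d_v$ is the largest number of points of $\mathcal Z\times\mathbb R$ shattered by the family of subgraphs $\{(x,t): t<f(x)\}$, $f\in\mathcal F_r$. Let $n\ge 1$, let $z_1,\dots,z_n$ be i.i.d. samples from $P$, and for $\rho\in\mathbb R$ define the DRRho risk $$F(\theta)=\sup\Big\{\sum_{i=1}^n p_i\big(\ell(\theta,z_i)-\ell(\theta_{\mathrm{ref}},z_i)\big)\;:\;p\in\mathbb R^n,\ p\ge 0,\ \sum_{i=1}^n p_i=1,\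 \frac1n\sum_{i=1}^n\frac{(np_i-1)^2}{2}\le\frac{\rho}{n}\Big\}.$$ Let $\tilde\theta_*=\tilde\theta_*(z_1,\dots,z_n)$ satisfy $\tilde\theta_*\in\operatorname{argmin}_{\theta\in\Theta}F(\theta)$ almost surely, where $(z_1,\dots,z_n,x)\mapsto\ell(\tilde\theta_*(z_1,\dots,z_n),x)$ is measurable. For $\delta>0$ let $$C_1=\log\tfrac1\delta+\log c+d_v\log(16e)+2d_v\log n,\qquad C_2=\Big(\frac{50\rho}{3}+4\Big)M.$$ If $C_1\, n\ge 32M^2$ and $\rho\ge 9C_1$, then with probability at least $1-\delta$, $$R(\tilde\theta_*)-R(\theta_*)\le R(\theta_{\mathrm{ref}})-R(\theta_*)+\frac{C_2}{n}.$$ -/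

import Mathlib

open MeasureTheory

namespace DRRho

/-- A family `C` of subsets of `α` shatters a finite set `s` if every subset of `s` is the
intersection of `s` with a member of `C`. -/
def Shatters {α : Type*} (C : Set (Set α)) (s : Finset α) : Prop :=
  ∀ t : Set α, t ⊆ (s : Set α) → ∃ A ∈ C, (s : Set α) ∩ A = t

/-- The VC-dimension of a family of sets: the supremum of the cardinalities of the finite sets
that it shatters (`⊤` if there are shattered sets of arbitrarily large size). -/
noncomputable def vcDim {α : Type*} (C : Set (Set α)) : ℕ∞ :=
  ⨆ (s : Finset α) (_ : Shatters C s), (s.card : ℕ∞)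

/-- The subgraph of a real-valued function. -/
def subgraph {Z : Type*} (f : Z → ℝ) : Set (Z × ℝ) := {q | q.2 < f q.1}

/-- The VC-dimension of a class of real-valued functions: the VC-dimension of the family of the
subgraphs of its members. -/
noncomputable def vcDimFun {Z : Type*} (G : Set (Z → ℝ)) : ℕ∞ := vcDim (subgraph '' G)

/-- The `φ`-divergence `D_φ(p, 1/n) = (1/n) ∑ φ(n pᵢ)` of the weights `p` from uniform weights. -/
noncomputable def phiDiv (φ : ℝ → ℝ) {n : ℕ} (p : Fin n → ℝ) : ℝ :=
  (1 / (n : ℝ)) * ∑ i, φ (p i * n)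

/-- The generator `φ(t) = (t - 1)² / 2` of the `χ²`-divergence. -/
noncomputable def chiSqPhi (t : ℝ) : ℝ := (t - 1) ^ 2 / 2

/-- The uncertainty set: probability weights `p` on `n` points with `D_φ(p, 1/n) ≤ ρ / n`, for
the `χ²`-divergence. -/
def uncertaintySet (n : ℕ) (ρ : ℝ) : Set (Fin n → ℝ) :=
  {p | p ∈ stdSimplex ℝ (Fin n) ∧ phiDiv chiSqPhi p ≤ ρ / n}

variable {W Z : Type*}

/-- The RHO loss `ℓ(θ, z) - ℓ(θref, z)`. -/
def rhoLoss (ℓ : W → Z → ℝ) (θref θ : W) (z : Z) : ℝ := ℓ θ z - ℓ θref z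

/-- The class `{ℓ(θ, ·) - ℓ(θref, ·) : θ ∈ Θ}`. -/
def rhoClass (ℓ : W → Z → ℝ) (Θ : Set W) (θref : W) : Set (Z → ℝ) := rhoLoss ℓ θref '' Θ

/-- The DRRho risk `F(θ)` on the sample `z`: the supremum over the uncertainty set of the
weighted sums of the RHO losses. -/
noncomputable def drrhoRisk (ℓ : W → Z → ℝ) (θref : W) (ρ : ℝ) {n : ℕ} (z : Fin n → Z)
    (θ : W) : ℝ :=
  sSup ((fun p : Fin n → ℝ => ∑ i, p i * rhoLoss ℓ θref θ (z i)) '' uncertaintySet n ρ)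

/-- The expected risk `R(θ) = E_{z ∼ P} ℓ(θ, z)`. -/
noncomputable def risk [MeasurableSpace Z] (P : Measure Z) (ℓ : W → Z → ℝ) (θ : W) : ℝ :=
  ∫ x, ℓ θ x ∂P

/-- `C₁ = log (1/δ) + log c + d log (16 e) + 2 d log n`. -/
noncomputable def constC1 (c δ : ℝ) (d n : ℕ) : ℝ :=
  Real.log (1 / δ) + Real.log c + d * Real.log (16 * Real.exp 1) + 2 * d * Real.log n

/-- `C₂ = (50 ρ / 3 + 4) M`. -/
noncomputable def constC2 (ρ M : ℝ) : ℝ := (50 * ρ / 3 + 4) * M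

end DRRho

/-!
Write `f` for the loss of the learned model relative to the reference model. It takes values in
`[-M, M]`, and the claim is that its mean exceeds `C₂ / n` with probability at most `δ`.

The reference model has DRRho risk zero, so no weights in the uncertainty set give a positive
weighted sum of `f` over the sample. Testing this with the linearly tilted weights
`(1 + l (f zᵢ - mean)) / n` shows that the sum `Sa` of `f` over the sample is at most a constant
times `-min (Qa / M) (√(ρ Qa))`, where `Qa` is the sum of `f²` over the sample
(`sum_add_mul_sum_sq_nonpos`). On the other hand a uniform Bernstein inequality with exponent
`τ = C₁` bounds the excess of `n` times the mean of `f` over `Sa` by terms of order `√(τ Qa)`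
and `τ M`. As `ρ ≥ 9 τ`, the negative term absorbs the first of these, and what remains is at most
`C₂` (`ghost_sum_le`).

The Bernstein inequality comes from symmetrization. By Chebyshev's inequality for the sums of `f`
and of `f²`, a ghost sample detects a large mean with probability at least `1 / 2`
(`half_le_measure_lt_ghost_sum`). Exchanging entries of the sample with those of the ghost sample
preserves the product measure, which reduces the question to counting exchanges for a fixed double
sample (`measure_le_of_card_swapCoords_le`). For this count the class is replaced by a net of
precision `M / (4 n)` with at most `(16 n² + 1) ^ d` members, which the Sauer–Shelah lemma provides
(`exists_finset_net`), and for each of them Hoeffding's inequality for random signs is applied to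
the first and to the second moments (`card_sqrt_lt_signed_sum_le`). The exponent `C₁` is just large
enough to pay for the size of the net, and the constant `c = exp 25` ensures `C₁ ≥ 25` for
`δ ≤ 1`, which makes the fluctuation of the ghost sample small compared with the other terms.

Suprema over the class need not be measurable; all sets whose measure is taken after symmetrization
are defined through the learned model, which depends measurably on the sample.
-/

namespace DRRho

/-! ### Finite nets from Sauer–Shelah -/

lemma sum_Iic_choose_le (m d : ℕ) : ∑ k ∈ Finset.Iic d, m.choose k ≤ (m + 1) ^ d := by
  rw [← Nat.range_succ_eq_Iic]
  induction d with
  | zero => simp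
  | succ d ih =>
    rw [Finset.sum_range_succ]
    have h1 : m.choose (d + 1) ≤ m ^ (d + 1) := Nat.choose_le_pow _ _
    have h2 : m ^ d ≤ (m + 1) ^ d := Nat.pow_le_pow_left (by omega) d
    have h3 : m * m ^ d ≤ m * (m + 1) ^ d := Nat.mul_le_mul_left m h2
    rw [pow_succ' m] at h1
    rw [pow_succ' (m + 1)]
    linarith

/-- A class of functions into `[-M, M]` whose subgraphs have VC-dimension at most `d` has, on any
finite set of points, a `2M / K`-net in the sup norm of polynomial size, consisting of members of
the class: the Sauer–Shelah lemma bounds the number of traces of the subgraphs on the grid of the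
given points and `K` equidistant levels, and functions with the same trace are close. -/
lemma exists_finset_net {Z ι : Type*} [Fintype ι] {G : Set (Z → ℝ)} {M : ℝ} {d : ℕ}
    (hM : 0 < M) (hG : ∀ f ∈ G, ∀ x, |f x| ≤ M) (hd : vcDimFun G ≤ d) (x : ι → Z)
    {K : ℕ} (hK : 0 < K) :
    ∃ H : Finset (Z → ℝ), (∀ g ∈ H, g ∈ G) ∧ H.card ≤ (Fintype.card ι * K + 1) ^ d ∧
      ∀ f ∈ G, ∃ g ∈ H, ∀ i, |f (x i) - g (x i)| ≤ 2 * M / K := by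
  classical
  have hK' : (0 : ℝ) < K := by exact_mod_cast hK
  set pt : ι × Fin K → Z × ℝ := fun q => (x q.1, -M + (q.2 : ℕ) * (2 * M / K)) with hpt
  set tr : (Z → ℝ) → Finset (ι × Fin K) := fun f => {q | pt q ∈ subgraph f} with htr
  set A : Finset (Finset (ι × Fin K)) := (Set.toFinite (tr '' G)).toFinset with hA
  have hmemA : ∀ u, u ∈ A ↔ ∃ f ∈ G, tr f = u := by simp [hA]
  have hshat : ∀ u : Finset (ι × Fin K), A.Shatters u → u.card ≤ d := by
    intro u hu
    -- indices with the same grid point cannot be separated, so `pt` is injective on `u`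
    have hinj : Set.InjOn pt u := by
      intro a ha b hb hab
      obtain ⟨v, hv, hva⟩ := hu (t := {a}) (by simpa using ha)
      obtain ⟨f, -, rfl⟩ := (hmemA v).1 hv
      have h1 : a ∈ u ∩ tr f := by rw [hva]; simp
      have h2 : b ∈ u ∩ tr f := by
        simp only [htr, Finset.mem_inter, Finset.mem_filter, Finset.mem_univ, true_and] at h1 ⊢
        exact ⟨hb, hab ▸ h1.2⟩
      rw [hva] at h2
      exact (Finset.mem_singleton.1 h2).symm
    have hS : Shatters (subgraph '' G) (u.image pt) := by
      intro t ht
      obtain ⟨v, hv, hvt⟩ := hu (t := u.filter fun q => pt q ∈ t) (Finset.filter_subset _ _)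
      obtain ⟨f, hf, rfl⟩ := (hmemA v).1 hv
      refine ⟨subgraph f, ⟨f, hf, rfl⟩, ?_⟩
      have key : ∀ q ∈ u, pt q ∈ subgraph f ↔ pt q ∈ t := by
        intro q hq
        have := congrArg (fun s => q ∈ s) hvt
        simpa [htr, hq] using this
      ext y
      constructor
      · rintro ⟨hy, hyf⟩
        obtain ⟨q, hq, rfl⟩ := Finset.mem_image.1 (Finset.mem_coe.1 hy)
        exact (key q hq).1 hyf
      · intro hy
        have hy' := ht hy
        obtain ⟨q, hq, rfl⟩ := Finset.mem_image.1 (Finset.mem_coe.1 hy')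
        exact ⟨hy', (key q hq).2 hy⟩
    have h1 : ((u.image pt).card : ℕ∞) ≤ vcDimFun G :=
      le_iSup₂ (f := fun (s : Finset (Z × ℝ)) (_ : Shatters (subgraph '' G) s) => (s.card : ℕ∞))
        (u.image pt) hS
    rw [Finset.card_image_of_injOn hinj] at h1
    exact_mod_cast h1.trans hd
  have hvc : A.vcDim ≤ d := Finset.sup_le fun u hu => hshat u (Finset.mem_shatterer.1 hu)
  have hcard : A.card ≤ (Fintype.card ι * K + 1) ^ d := by
    calc A.card ≤ A.shatterer.card := Finset.card_le_card_shatterer A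
      _ ≤ ∑ k ∈ Finset.Iic A.vcDim, (Fintype.card (ι × Fin K)).choose k :=
        Finset.card_shatterer_le_sum_vcDim
      _ ≤ ∑ k ∈ Finset.Iic d, (Fintype.card (ι × Fin K)).choose k :=
        Finset.sum_le_sum_of_subset (Finset.Iic_subset_Iic.2 hvc)
      _ ≤ (Fintype.card (ι × Fin K) + 1) ^ d := sum_Iic_choose_le _ _
      _ = _ := by simp
  have hchoice : ∀ u, ∃ f, u ∈ A → f ∈ G ∧ tr f = u := by
    intro u
    by_cases hu : u ∈ A
    · obtain ⟨f, hf⟩ := (hmemA u).1 hu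
      exact ⟨f, fun _ => hf⟩
    · exact ⟨0, fun h => absurd h hu⟩
  choose rep hrep using hchoice
  -- functions with the same trace are separated at no point by more than one grid step
  have close : ∀ f ∈ G, ∀ g ∈ G, tr f = tr g → ∀ i, g (x i) - f (x i) ≤ 2 * M / K := by
    intro f hf g hg hfg i
    by_contra! hlt
    have hfi := abs_le.1 (hG f hf (x i))
    have hgi := abs_le.1 (hG g hg (x i))
    have hε : 0 < 2 * M / K := by positivity
    set k := ⌈(f (x i) + M) / (2 * M / K)⌉₊ with hk
    have hk1 : f (x i) + M ≤ k * (2 * M / K) := (div_le_iff₀ hε).1 (Nat.le_ceil _)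
    have hk2 : k * (2 * M / K) < f (x i) + M + 2 * M / K := by
      have := Nat.ceil_lt_add_one (a := (f (x i) + M) / (2 * M / K))
        (div_nonneg (by linarith) hε.le)
      rw [← hk] at this
      calc k * (2 * M / K) < ((f (x i) + M) / (2 * M / K) + 1) * (2 * M / K) := by gcongr
        _ = _ := by field_simp
    have hkK : k < K := by
      have h1 : (k : ℝ) * (2 * M / K) < K * (2 * M / K) := by
        have : (K : ℝ) * (2 * M / K) = 2 * M := by field_simp
        linarith
      exact_mod_cast lt_of_mul_lt_mul_right h1 hε.le
    have hmem : (i, (⟨k, hkK⟩ : Fin K)) ∈ tr g := by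
      simp only [htr, hpt, subgraph, Finset.mem_filter, Finset.mem_univ, true_and,
        Set.mem_ofPred_eq]
      linarith
    rw [← hfg] at hmem
    simp only [htr, hpt, subgraph, Finset.mem_filter, Finset.mem_univ, true_and,
      Set.mem_ofPred_eq] at hmem
    linarith
  refine ⟨A.image rep, ?_, Finset.card_image_le.trans hcard, ?_⟩
  · intro g hg
    obtain ⟨u, hu, rfl⟩ := Finset.mem_image.1 hg
    exact (hrep u hu).1
  · intro f hf
    have hu : tr f ∈ A := (hmemA _).2 ⟨f, hf, rfl⟩
    refine ⟨rep (tr f), Finset.mem_image_of_mem _ hu, fun i => abs_le.2 ⟨?_, ?_⟩⟩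
    · linarith [close f hf _ (hrep _ hu).1 (hrep _ hu).2.symm i]
    · exact close _ (hrep _ hu).1 f hf (hrep _ hu).2 i

/-! ### Random signs -/

/-- Hoeffding's inequality for the uniform distribution on sign patterns, in counting form. -/
lemma card_sqrt_lt_signed_sum_le {ι : Type*} [Fintype ι] [DecidableEq ι] (v : ι → ℝ) {τ : ℝ}
    (hτ : 0 ≤ τ) :
    (({s : ι → Bool | √(2 * τ * ∑ i, v i ^ 2) < ∑ i, if s i then -v i else v i} :
      Finset (ι → Bool)).card : ℝ) ≤ Real.exp (-τ) * 2 ^ Fintype.card ι := by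
  set V := ∑ i, v i ^ 2 with hV
  have hV0 : 0 ≤ V := Finset.sum_nonneg fun i _ => sq_nonneg _
  set S : Finset (ι → Bool) := {s | √(2 * τ * V) < ∑ i, if s i then -v i else v i} with hS
  rcases hV0.eq_or_lt with h0 | hVpos
  · have hv : ∀ i, v i = 0 := fun i => by
      have := (Finset.sum_eq_zero_iff_of_nonneg (fun i _ => sq_nonneg (v i))).1 h0.symm i
        (Finset.mem_univ i)
      simpa using this
    have : S = ∅ := by
      ext s
      simp [hS, hv, ← h0]
    rw [this]
    simp only [Finset.card_empty, Nat.cast_zero]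
    positivity
  set t := √(2 * τ * V) with ht
  have htsq : t ^ 2 = 2 * τ * V := Real.sq_sqrt (by positivity)
  -- the minimizer of the Chernoff bound
  set l := t / V with hl
  have hl0 : 0 ≤ l := by positivity
  have h1 : (S.card : ℝ) * Real.exp (2 * τ) ≤
      ∑ s : ι → Bool, Real.exp (l * ∑ i, if s i then -v i else v i) := by
    have hlt : l * t = 2 * τ := by
      rw [hl]; field_simp; linarith
    calc (S.card : ℝ) * Real.exp (2 * τ) = ∑ s ∈ S, Real.exp (l * t) := by
          rw [hlt, Finset.sum_const, nsmul_eq_mul]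
      _ ≤ ∑ s ∈ S, Real.exp (l * ∑ i, if s i then -v i else v i) := by
          refine Finset.sum_le_sum fun s hs => ?_
          have := (Finset.mem_filter.1 hs).2
          gcongr
      _ ≤ _ := Finset.sum_le_sum_of_subset_of_nonneg (Finset.subset_univ _)
          fun _ _ _ => (Real.exp_pos _).le
  have h2 : ∑ s : ι → Bool, Real.exp (l * ∑ i, if s i then -v i else v i) =
      ∏ i, (2 * Real.cosh (l * v i)) := by
    have : ∀ i, 2 * Real.cosh (l * v i) =
        ∑ b : Bool, Real.exp (l * if b then -v i else v i) := by
      intro i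
      rw [Real.cosh_eq]
      simp
      ring
    simp_rw [this, Fintype.prod_sum, ← Real.exp_sum, Finset.mul_sum]
  have h3 : ∏ i, (2 * Real.cosh (l * v i)) ≤ 2 ^ Fintype.card ι * Real.exp τ := by
    calc ∏ i, (2 * Real.cosh (l * v i)) ≤ ∏ i, (2 * Real.exp ((l * v i) ^ 2 / 2)) := by
          refine Finset.prod_le_prod (fun i _ => by have := Real.cosh_pos (l * v i); positivity)
            fun i _ => ?_
          gcongr
          exact Real.cosh_le_exp_half_sq _
      _ = 2 ^ Fintype.card ι * Real.exp τ := by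
          rw [Finset.prod_mul_distrib, ← Real.exp_sum, Finset.prod_const, Finset.card_univ]
          congr 2
          have : ∀ i, (l * v i) ^ 2 / 2 = l ^ 2 / 2 * v i ^ 2 := fun i => by ring
          simp_rw [this, ← Finset.mul_sum, ← hV, hl, div_pow, htsq]
          field_simp
  have h4 : (S.card : ℝ) * Real.exp (2 * τ) ≤ 2 ^ Fintype.card ι * Real.exp τ :=
    h1.trans (h2.le.trans h3)
  have h5 : Real.exp (2 * τ) = Real.exp τ * Real.exp τ := by rw [← Real.exp_add]; ring_nf
  rw [Real.exp_neg, inv_mul_eq_div, le_div_iff₀ (Real.exp_pos _)]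
  rw [h5, ← mul_assoc] at h4
  exact le_of_mul_le_mul_right h4 (Real.exp_pos _)

/-! ### Symmetrization -/

/-- A sequence of pairs with the two entries exchanged at the positions marked by `s`. -/
def swapCoords {ι Z : Type*} (s : ι → Bool) (w : ι → Z × Z) : ι → Z × Z :=
  fun i => if s i then (w i).swap else w i

lemma measurePreserving_swapCoords {ι Z : Type*} [Fintype ι] [MeasurableSpace Z] (P : Measure Z)
    [SigmaFinite P] (s : ι → Bool) :
    MeasurePreserving (swapCoords (Z := Z) s) (Measure.pi fun _ : ι => P.prod P)
      (Measure.pi fun _ : ι => P.prod P) := by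
  refine measurePreserving_pi (f := fun i (q : Z × Z) => if s i then q.swap else q) _ _ fun i => ?_
  cases s i
  · exact MeasurePreserving.id (P.prod P)
  · simpa using Measure.measurePreserving_swap (μ := P) (ν := P)

/-- The measure of a set of sequences of pairs is at most the largest fraction of the exchanges
that move a fixed sequence into the set. -/
lemma measure_le_of_card_swapCoords_le {ι Z : Type*} [Fintype ι] [DecidableEq ι]
    [MeasurableSpace Z] (P : Measure Z) [IsProbabilityMeasure P] {B : Set (ι → Z × Z)}
    [DecidablePred (· ∈ B)] (hB : MeasurableSet B) {p : ℝ}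
    (h : ∀ w, (({s : ι → Bool | swapCoords s w ∈ B} : Finset (ι → Bool)).card : ℝ) ≤
      p * 2 ^ Fintype.card ι) :
    (Measure.pi fun _ : ι => P.prod P) B ≤ ENNReal.ofReal p := by
  set μ := Measure.pi fun _ : ι => P.prod P with hμ
  have h1 : ∑ s : ι → Bool, μ (swapCoords s ⁻¹' B) = 2 ^ Fintype.card ι * μ B := by
    rw [Finset.sum_congr rfl fun s _ =>
      (measurePreserving_swapCoords P s).measure_preimage hB.nullMeasurableSet]
    simp [hμ]
  have h2 : ∑ s : ι → Bool, μ (swapCoords s ⁻¹' B) =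
      ∫⁻ w, ∑ s : ι → Bool, (swapCoords s ⁻¹' B).indicator 1 w ∂μ := by
    have hm : ∀ s : ι → Bool, MeasurableSet (swapCoords (Z := Z) s ⁻¹' B) := fun s =>
      (measurePreserving_swapCoords P s).measurable hB
    rw [lintegral_finsetSum _ fun s _ => measurable_one.indicator (hm s)]
    exact Finset.sum_congr rfl fun s _ => (lintegral_indicator_one (hm s)).symm
  have h3 : ∀ w, ∑ s : ι → Bool, (swapCoords s ⁻¹' B).indicator (1 : (ι → Z × Z) → ENNReal) w ≤
      ENNReal.ofReal (p * 2 ^ Fintype.card ι) := by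
    intro w
    have : ∑ s : ι → Bool, (swapCoords s ⁻¹' B).indicator (1 : (ι → Z × Z) → ENNReal) w =
        ENNReal.ofReal ((({s : ι → Bool | swapCoords s w ∈ B} : Finset (ι → Bool)).card : ℝ)) := by
      rw [ENNReal.ofReal_natCast, Finset.card_filter]
      push_cast
      refine Finset.sum_congr rfl fun s _ => ?_
      by_cases hs : swapCoords s w ∈ B <;> simp [hs]
    rw [this]
    exact ENNReal.ofReal_le_ofReal (h w)
  have h4 : 2 ^ Fintype.card ι * μ B ≤ 2 ^ Fintype.card ι * ENNReal.ofReal p := by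
    rw [← h1, h2]
    calc _ ≤ ∫⁻ _, ENNReal.ofReal (p * 2 ^ Fintype.card ι) ∂μ := lintegral_mono h3
      _ = ENNReal.ofReal (p * 2 ^ Fintype.card ι) := by simp
      _ = 2 ^ Fintype.card ι * ENNReal.ofReal p := by
        rw [ENNReal.ofReal_mul' (by positivity), ENNReal.ofReal_pow (by norm_num), mul_comm]
        simp
  exact (ENNReal.mul_le_mul_iff_right (by simp) (by simp)).1 h4

/-- Ghost sample: if every point of `B` has a section of measure at least `1 / 2` in `C`, then the
measure of `B` is at most twice that of `C`. -/
lemma measure_le_two_mul_prod {Ω Ω' : Type*} [MeasurableSpace Ω] [MeasurableSpace Ω']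
    (μ : Measure Ω) (ν : Measure Ω') [SFinite ν] {B : Set Ω} {C : Set (Ω × Ω')}
    (hC : MeasurableSet C) (h : ∀ z ∈ B, 1 / 2 ≤ ν {y | (z, y) ∈ C}) :
    μ B ≤ 2 * μ.prod ν C := by
  have h1 : (1 / 2 : ENNReal) * μ B ≤ μ.prod ν C := by
    rw [Measure.prod_apply hC]
    refine le_trans ?_ (mul_meas_ge_le_lintegral (measurable_measure_prodMk_left hC) (1 / 2))
    gcongr
    exact h
  calc μ B = 2 * (1 / 2 * μ B) := by
        rw [← mul_assoc, one_div, ENNReal.mul_inv_cancel (by simp) (by simp), one_mul]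
    _ ≤ _ := by gcongr

/-! ### Chebyshev's inequality for sample sums -/

lemma measure_sum_add_lt_le {ι Z : Type*} [Fintype ι] [MeasurableSpace Z] (P : Measure Z)
    [IsProbabilityMeasure P] {g : Z → ℝ} {B t : ℝ} (hg : Measurable g) (hB : ∀ x, |g x| ≤ B)
    (ht : 0 < t) :
    (Measure.pi fun _ : ι => P) {y | ∑ i, g (y i) + t < Fintype.card ι * ∫ x, g x ∂P} ≤
      ENNReal.ofReal (Fintype.card ι * (∫ x, g x ^ 2 ∂P) / t ^ 2) := by
  have hL : MemLp g 2 P := MemLp.of_bound hg.aestronglyMeasurable B (.of_forall hB)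
  have hLi : ∀ i : ι, MemLp (fun y : ι → Z => g (y i)) 2 (Measure.pi fun _ : ι => P) := fun i =>
    hL.comp_measurePreserving (measurePreserving_eval _ i)
  have hsum : (fun y : ι → Z => ∑ i, g (y i)) = ∑ i, fun y : ι → Z => g (y i) := by
    ext y; simp
  have hLs : MemLp (fun y : ι → Z => ∑ i, g (y i)) 2 (Measure.pi fun _ : ι => P) :=
    memLp_finsetSum _ fun i _ => hLi i
  have hE : ∫ y, ∑ i, g (y i) ∂(Measure.pi fun _ : ι => P) =
      Fintype.card ι * ∫ x, g x ∂P := by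
    rw [integral_finsetSum _ fun i _ => (hLi i).integrable (by norm_num)]
    rw [Finset.sum_congr rfl fun i _ =>
      integral_comp_eval (μ := fun _ : ι => P) (i := i) hg.aestronglyMeasurable]
    simp
  have hV : ProbabilityTheory.variance (fun y : ι → Z => ∑ i, g (y i))
      (Measure.pi fun _ : ι => P) ≤ Fintype.card ι * ∫ x, g x ^ 2 ∂P := by
    rw [hsum, ProbabilityTheory.variance_sum_pi (μ := fun _ : ι => P) (X := fun _ => g)
      fun _ => hL]
    simp only [Finset.sum_const, Finset.card_univ, nsmul_eq_mul]
    gcongr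
    exact ProbabilityTheory.variance_le_expectation_sq hg.aestronglyMeasurable
  have hc := ProbabilityTheory.meas_ge_le_variance_div_sq hLs ht
  refine (measure_mono ?_).trans (hc.trans (ENNReal.ofReal_le_ofReal (by gcongr)))
  intro y hy
  simp only [Set.mem_ofPred_eq] at hy ⊢
  rw [hE, abs_sub_comm]
  exact (by linarith : t ≤ _).trans (le_abs_self _)

/-- With probability at least `1 / 2`, a sample controls both the mean and the second moment of a
bounded function from above, up to errors of the order of the standard deviations of the sample
sums. -/
lemma half_le_measure_sum_and_sum_sq {ι Z : Type*} [Fintype ι] [MeasurableSpace Z] (P : Measure Z)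
    [IsProbabilityMeasure P] {f : Z → ℝ} {M : ℝ} (hf : Measurable f) (hM : 0 < M)
    (hfM : ∀ x, |f x| ≤ M) {D : ℝ} (hD : D = √(4 * (Fintype.card ι * ∫ x, f x ^ 2 ∂P) + M ^ 2)) :
    1 / 2 ≤ (Measure.pi fun _ : ι => P)
      {y | Fintype.card ι * ∫ x, f x ∂P ≤ ∑ i, f (y i) + D ∧
        Fintype.card ι * ∫ x, f x ^ 2 ∂P ≤ ∑ i, f (y i) ^ 2 + M * D} := by
  set q := Fintype.card ι * ∫ x, f x ^ 2 ∂P with hq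
  have hq0 : 0 ≤ q := mul_nonneg (by positivity) (integral_nonneg fun x => sq_nonneg _)
  have hD2 : D ^ 2 = 4 * q + M ^ 2 := by rw [hD]; exact Real.sq_sqrt (by positivity)
  have hDpos : 0 < D := by rw [hD]; positivity
  have hsq : ∀ x, f x ^ 2 ≤ M ^ 2 := fun x => sq_le_sq' (abs_le.1 (hfM x)).1 (abs_le.1 (hfM x)).2
  set μ := Measure.pi fun _ : ι => P with hμ
  have h1 : μ {y | ∑ i, f (y i) + D < Fintype.card ι * ∫ x, f x ∂P} ≤ ENNReal.ofReal (1 / 4) := by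
    refine (measure_sum_add_lt_le P hf hfM hDpos).trans (ENNReal.ofReal_le_ofReal ?_)
    rw [← hq, div_le_iff₀ (by positivity), hD2]
    nlinarith [sq_nonneg M]
  have h2 : μ {y | ∑ i, f (y i) ^ 2 + M * D < Fintype.card ι * ∫ x, f x ^ 2 ∂P} ≤
      ENNReal.ofReal (1 / 4) := by
    refine (measure_sum_add_lt_le (g := fun x => f x ^ 2) (B := M ^ 2) P (hf.pow_const 2)
      (fun x => by rw [abs_of_nonneg (sq_nonneg _)]; exact hsq x)
      (by positivity)).trans (ENNReal.ofReal_le_ofReal ?_)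
    have h4 : (Fintype.card ι : ℝ) * ∫ x, (f x ^ 2) ^ 2 ∂P ≤ M ^ 2 * q := by
      rw [hq, mul_left_comm, ← integral_const_mul (M ^ 2)]
      refine mul_le_mul_of_nonneg_left (integral_mono ?_ ?_ ?_) (Nat.cast_nonneg _)
      · refine Integrable.of_bound (C := M ^ 2 * M ^ 2)
          ((hf.pow_const 2).pow_const 2).aestronglyMeasurable (.of_forall fun x => ?_)
        rw [Real.norm_of_nonneg (by positivity), sq (f x ^ 2)]
        exact mul_le_mul (hsq x) (hsq x) (by positivity) (by positivity)
      · refine Integrable.of_bound (C := M ^ 2 * M ^ 2)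
          ((hf.pow_const 2).const_mul _).aestronglyMeasurable (.of_forall fun x => ?_)
        rw [Real.norm_of_nonneg (by positivity)]
        exact mul_le_mul_of_nonneg_left (hsq x) (by positivity)
      · intro x
        simp only
        rw [sq (f x ^ 2)]
        exact mul_le_mul_of_nonneg_right (hsq x) (by positivity)
    rw [div_le_iff₀ (by positivity), mul_pow, hD2]
    nlinarith [sq_nonneg M, sq_nonneg (M * M)]
  set E := {y : ι → Z | Fintype.card ι * ∫ x, f x ∂P ≤ ∑ i, f (y i) + D ∧
        q ≤ ∑ i, f (y i) ^ 2 + M * D} with hE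
  have hcov : (Set.univ : Set (ι → Z)) ⊆ E ∪
      ({y | ∑ i, f (y i) + D < Fintype.card ι * ∫ x, f x ∂P} ∪
        {y | ∑ i, f (y i) ^ 2 + M * D < Fintype.card ι * ∫ x, f x ^ 2 ∂P}) := by
    intro y _
    by_cases ha : ∑ i, f (y i) + D < Fintype.card ι * ∫ x, f x ∂P
    · exact Or.inr (Or.inl ha)
    by_cases hb : ∑ i, f (y i) ^ 2 + M * D < q
    · exact Or.inr (Or.inr hb)
    exact Or.inl ⟨not_lt.1 ha, not_lt.1 hb⟩
  have h3 : (1 : ENNReal) ≤ μ E + ENNReal.ofReal (1 / 2) := by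
    calc (1 : ENNReal) = μ Set.univ := by simp [hμ]
      _ ≤ μ E + (ENNReal.ofReal (1 / 4) + ENNReal.ofReal (1 / 4)) :=
        (measure_mono hcov).trans ((measure_union_le _ _).trans
          (add_le_add le_rfl ((measure_union_le _ _).trans (add_le_add h1 h2))))
      _ = _ := by rw [← ENNReal.ofReal_add (by norm_num) (by norm_num)]; norm_num
  have h4 : ENNReal.ofReal (1 / 2) = 1 / 2 := by
    rw [ENNReal.ofReal_div_of_pos (by norm_num)]; simp
  rw [h4] at h3
  rw [← ENNReal.sub_half ENNReal.one_ne_top]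
  exact tsub_le_iff_right.2 h3

/-! ### Tilted weights -/

/-- Tilting the uniform weights linearly in the direction of the centred data gives weights in the
uncertainty set, as long as the tilt keeps them nonnegative and of small `χ²`-divergence. -/
lemma tilted_mem_uncertaintySet {n : ℕ} (hn : 0 < n) {a : Fin n → ℝ} {M l ρ : ℝ}
    (ha : ∀ i, |a i| ≤ M) (hl : 0 ≤ l) (hlM : 2 * l * M ≤ 1) (hlρ : l ^ 2 * ∑ i, a i ^ 2 ≤ 2 * ρ) :
    (fun i => (1 + l * (a i - (∑ j, a j) / n)) / n) ∈ uncertaintySet n ρ := by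
  have hn' : (0 : ℝ) < n := by exact_mod_cast hn
  set m := (∑ j, a j) / n with hm
  have hmn : ∑ j, a j = n * m := by rw [hm]; field_simp
  have hmM : m ≤ M := by
    rw [hm, div_le_iff₀ hn']
    calc ∑ j, a j ≤ ∑ _j : Fin n, M := Finset.sum_le_sum fun j _ => (abs_le.1 (ha j)).2
      _ = M * n := by simp [mul_comm]
  refine ⟨⟨fun i => ?_, ?_⟩, ?_⟩
  · have : -M ≤ a i := (abs_le.1 (ha i)).1
    refine div_nonneg ?_ hn'.le
    nlinarith
  · rw [← Finset.sum_div, Finset.sum_add_distrib, ← Finset.mul_sum, Finset.sum_sub_distrib, hmn]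
    simp [hn.ne']
  · have h1 : ∀ i, chiSqPhi ((1 + l * (a i - m)) / n * n) =
        l ^ 2 / 2 * (a i ^ 2 - 2 * m * a i + m ^ 2) := by
      intro i
      rw [chiSqPhi, div_mul_cancel₀ _ hn'.ne']
      ring
    have h2 : ∑ i, chiSqPhi ((1 + l * (a i - m)) / n * n) =
        l ^ 2 / 2 * (∑ i, a i ^ 2 - n * m ^ 2) := by
      simp_rw [h1]
      rw [← Finset.mul_sum, Finset.sum_add_distrib, Finset.sum_sub_distrib, ← Finset.mul_sum, hmn]
      simp
      left
      ring
    rw [phiDiv, h2, one_div, inv_mul_eq_div]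
    gcongr
    have : 0 ≤ l ^ 2 * (n * m ^ 2) := by positivity
    linarith

/-- If no weights in the uncertainty set give a positive weighted sum, then the plain sum is
negative enough to compensate for the second moment. -/
lemma sum_add_mul_sum_sq_nonpos {n : ℕ} (hn : 0 < n) {a : Fin n → ℝ} {M l ρ : ℝ}
    (ha : ∀ i, |a i| ≤ M) (hU : ∀ p ∈ uncertaintySet n ρ, ∑ i, p i * a i ≤ 0)
    (hl : 0 ≤ l) (hlM : 10 * l * M ≤ 1) (hρ : 0 ≤ ρ) (hlρ : l ^ 2 * ∑ i, a i ^ 2 ≤ 2 * ρ) :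
    11 * ∑ i, a i + 10 * l * ∑ i, a i ^ 2 ≤ 0 := by
  have hn' : (0 : ℝ) < n := by exact_mod_cast hn
  have hM : 0 ≤ M := (abs_nonneg _).trans (ha ⟨0, hn⟩)
  set m := (∑ j, a j) / n with hm
  have hmn : ∑ j, a j = n * m := by rw [hm]; field_simp
  have key : ∀ k, 0 ≤ k → 2 * k * M ≤ 1 → k ^ 2 * ∑ i, a i ^ 2 ≤ 2 * ρ →
      ∑ i, a i + k * (∑ i, a i ^ 2 - n * m ^ 2) ≤ 0 := by
    intro k hk hkM hkρ
    have h := hU _ (tilted_mem_uncertaintySet hn ha hk hkM hkρ)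
    have h1 : ∀ i, (1 + k * (a i - m)) / n * a i =
        (a i + k * (a i ^ 2 - m * a i)) / n := fun i => by ring
    simp_rw [← hm, h1] at h
    rw [← Finset.sum_div, div_le_iff₀ hn', zero_mul, Finset.sum_add_distrib, ← Finset.mul_sum,
      Finset.sum_sub_distrib, ← Finset.mul_sum] at h
    calc _ = ∑ i, a i + k * (∑ i, a i ^ 2 - m * ∑ i, a i) := by rw [hmn]; ring
      _ ≤ 0 := h
  have hS : ∑ i, a i ≤ 0 := by
    have := key 0 le_rfl (by simp) (by simpa using hρ)
    simpa using this
  have hm0 : -M ≤ m := by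
    rw [hm, le_div_iff₀ hn']
    calc -M * n = ∑ _j : Fin n, -M := by simp [mul_comm]
      _ ≤ ∑ j, a j := Finset.sum_le_sum fun j _ => (abs_le.1 (ha j)).1
  have h2 := key l hl (by nlinarith [mul_nonneg hl hM]) hlρ
  have h3 : l * (n * m ^ 2) ≤ -(∑ i, a i) / 10 := by
    have h4 : l * -m ≤ 1 / 10 := by nlinarith
    have h5 : l * (n * m ^ 2) = (l * -m) * -(∑ i, a i) := by rw [hmn]; ring
    rw [h5]
    nlinarith
  linarith

/-! ### The deterministic estimate -/

/-- A function close to one with controlled differences of first and second moments between the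
two halves of a double sample inherits the control, with a constant loss. -/
lemma moment_bounds_of_close {n : ℕ} {a b a' b' : Fin n → ℝ} {M τ : ℝ} (hM : 0 < M)
    (hτ : 0 ≤ τ) (hn : 0 < n)
    (ha : ∀ i, |a i| ≤ M) (hb : ∀ i, |b i| ≤ M) (ha' : ∀ i, |a' i| ≤ M) (hb' : ∀ i, |b' i| ≤ M)
    (haa : ∀ i, |a i - a' i| ≤ M / (4 * n)) (hbb : ∀ i, |b i - b' i| ≤ M / (4 * n))
    (h1 : ∑ i, (b' i - a' i) ≤ √(2 * τ * ∑ i, (b' i - a' i) ^ 2))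
    (h2 : ∑ i, (b' i ^ 2 - a' i ^ 2) ≤ √(2 * τ * ∑ i, (b' i ^ 2 - a' i ^ 2) ^ 2)) :
    ∑ i, b i - ∑ i, a i ≤ 2 * √(τ * (∑ i, a i ^ 2 + ∑ i, b i ^ 2 + M ^ 2)) + M / 2 ∧
      ∑ i, b i ^ 2 - ∑ i, a i ^ 2 ≤
        M * √(2 * τ * (∑ i, a i ^ 2 + ∑ i, b i ^ 2 + M ^ 2)) + M ^ 2 := by
  have hn' : (0 : ℝ) < n := by exact_mod_cast hn
  set ε := M / (4 * n) with hε
  have hnε : n * ε = M / 4 := by rw [hε]; field_simp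
  have hlin : ∀ u v : Fin n → ℝ, (∀ i, |u i - v i| ≤ ε) → ∑ i, u i ≤ ∑ i, v i + M / 4 := by
    intro u v huv
    calc ∑ i, u i ≤ ∑ i, (v i + ε) :=
          Finset.sum_le_sum fun i _ => by linarith [(abs_le.1 (huv i)).2]
      _ = _ := by rw [Finset.sum_add_distrib]; simp [hnε]
  have hquad : ∀ u v : Fin n → ℝ, (∀ i, |u i| ≤ M) → (∀ i, |v i| ≤ M) →
      (∀ i, |u i - v i| ≤ ε) → ∑ i, u i ^ 2 ≤ ∑ i, v i ^ 2 + M ^ 2 / 2 := by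
    intro u v hu hv huv
    calc ∑ i, u i ^ 2 ≤ ∑ i, (v i ^ 2 + ε * (2 * M)) := by
          refine Finset.sum_le_sum fun i _ => ?_
          have h3 : |u i + v i| ≤ 2 * M := (abs_add_le _ _).trans (by linarith [hu i, hv i])
          have h4 : (u i - v i) * (u i + v i) ≤ ε * (2 * M) := by
            refine (le_abs_self _).trans ?_
            rw [abs_mul]
            exact mul_le_mul (huv i) h3 (abs_nonneg _) ((abs_nonneg _).trans (huv i))
          nlinarith
      _ = _ := by
        rw [Finset.sum_add_distrib]
        simp
        rw [← mul_assoc, hnε]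
        ring
  have haa' : ∀ i, |a' i - a i| ≤ ε := fun i => abs_sub_comm (a i) (a' i) ▸ haa i
  have hbb' : ∀ i, |b' i - b i| ≤ ε := fun i => abs_sub_comm (b i) (b' i) ▸ hbb i
  have hQ : ∑ i, a' i ^ 2 + ∑ i, b' i ^ 2 ≤ ∑ i, a i ^ 2 + ∑ i, b i ^ 2 + M ^ 2 := by
    linarith [hquad a' a ha' ha haa', hquad b' b hb' hb hbb']
  constructor
  · have h3 : ∑ i, (b' i - a' i) ^ 2 ≤ 2 * (∑ i, a i ^ 2 + ∑ i, b i ^ 2 + M ^ 2) := by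
      calc ∑ i, (b' i - a' i) ^ 2 ≤ ∑ i, 2 * (a' i ^ 2 + b' i ^ 2) :=
            Finset.sum_le_sum fun i _ => by nlinarith [sq_nonneg (a' i + b' i)]
        _ = 2 * (∑ i, a' i ^ 2 + ∑ i, b' i ^ 2) := by
          rw [← Finset.mul_sum, Finset.sum_add_distrib]
        _ ≤ _ := by linarith
    have h4 : √(2 * τ * ∑ i, (b' i - a' i) ^ 2) ≤
        2 * √(τ * (∑ i, a i ^ 2 + ∑ i, b i ^ 2 + M ^ 2)) := by
      rw [show (2 : ℝ) = √(2 ^ 2) by simp, ← Real.sqrt_mul (by norm_num)]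
      apply Real.sqrt_le_sqrt
      simp only [Nat.ofNat_nonneg, Real.sqrt_sq]
      nlinarith [mul_le_mul_of_nonneg_left h3 hτ]
    rw [Finset.sum_sub_distrib] at h1
    linarith [hlin b b' hbb, hlin a' a haa']
  · have h3 : ∑ i, (b' i ^ 2 - a' i ^ 2) ^ 2 ≤
        M ^ 2 * (∑ i, a i ^ 2 + ∑ i, b i ^ 2 + M ^ 2) := by
      calc ∑ i, (b' i ^ 2 - a' i ^ 2) ^ 2 ≤ ∑ i, M ^ 2 * (a' i ^ 2 + b' i ^ 2) := by
            refine Finset.sum_le_sum fun i _ => ?_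
            have h5 : a' i ^ 2 ≤ M ^ 2 := sq_le_sq' (abs_le.1 (ha' i)).1 (abs_le.1 (ha' i)).2
            have h6 : b' i ^ 2 ≤ M ^ 2 := sq_le_sq' (abs_le.1 (hb' i)).1 (abs_le.1 (hb' i)).2
            nlinarith [mul_nonneg (sq_nonneg (a' i)) (sq_nonneg (b' i)),
              mul_nonneg (sq_nonneg (a' i)) (sub_nonneg.2 h5),
              mul_nonneg (sq_nonneg (b' i)) (sub_nonneg.2 h6)]
        _ = M ^ 2 * (∑ i, a' i ^ 2 + ∑ i, b' i ^ 2) := by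
          rw [← Finset.mul_sum, Finset.sum_add_distrib]
        _ ≤ _ := by gcongr
    have h4 : √(2 * τ * ∑ i, (b' i ^ 2 - a' i ^ 2) ^ 2) ≤
        M * √(2 * τ * (∑ i, a i ^ 2 + ∑ i, b i ^ 2 + M ^ 2)) := by
      rw [← Real.sqrt_sq hM.le, ← Real.sqrt_mul (by positivity), Real.sqrt_sq hM.le]
      apply Real.sqrt_le_sqrt
      nlinarith [mul_le_mul_of_nonneg_left h3 hτ]
    rw [Finset.sum_sub_distrib] at h2
    linarith [hquad b b' hb hb' hbb, hquad a' a ha' ha haa']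

/-- The upper bound for the ghost sample: `Sa`, `Sb` stand for the sums of a function over the
sample and the ghost sample and `Qa`, `Qb` for the sums of its squares. The deviation of `Sb` from
`Sa` is of order `√(τ Qa)`, and is absorbed by `Sa` because of `h0`. -/
lemma ghost_sum_le {M τ ρ Sa Sb Qa Qb : ℝ} (hM : 0 < M) (hτ : 25 ≤ τ) (hρ : 9 * τ ≤ ρ)
    (hQa : 0 ≤ Qa) (hQb : 0 ≤ Qb)
    (h0 : ∀ l, 0 ≤ l → 10 * l * M ≤ 1 → l ^ 2 * Qa ≤ 2 * ρ → 11 * Sa + 10 * l * Qa ≤ 0)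
    (h1 : Sb - Sa ≤ 2 * √(τ * (Qa + Qb + M ^ 2)) + M / 2)
    (h2 : Qb - Qa ≤ M * √(2 * τ * (Qa + Qb + M ^ 2)) + M ^ 2) :
    Sb + 2 * M + √(4 * Qb + 5 * M ^ 2) ≤ (50 * ρ / 3 + 4) * M := by
  set S := Qa + Qb + M ^ 2 with hS
  have hS0 : 0 ≤ S := by positivity
  have hM2 : 0 < M ^ 2 := by positivity
  have hτ0 : 0 < τ := by linarith
  have hS1 : S ≤ 20 / 9 * Qa + 6 * τ * M ^ 2 := by
    have h3 : M * √(2 * τ * S) ≤ S / 10 + 5 * τ * M ^ 2 := by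
      have h4 : √(2 * τ * S) ^ 2 = 2 * τ * S := Real.sq_sqrt (by positivity)
      refine le_of_sq_le_sq ?_ (by positivity)
      rw [mul_pow, h4]
      nlinarith [sq_nonneg (S / 10 - 5 * τ * M ^ 2)]
    nlinarith
  set r := √(τ * Qa) with hr
  have hr0 : 0 ≤ r := Real.sqrt_nonneg _
  have hr2 : r ^ 2 = τ * Qa := Real.sq_sqrt (by positivity)
  set y := √(τ * S) with hy
  have hy1 : y ≤ 3 / 2 * r + 5 / 2 * τ * M := by
    refine Real.sqrt_le_iff.2 ⟨by positivity, ?_⟩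
    have h3 : τ * S ≤ 20 / 9 * r ^ 2 + 6 * (τ * M) ^ 2 := by
      rw [hr2]; nlinarith [mul_le_mul_of_nonneg_left hS1 hτ0.le]
    nlinarith [mul_nonneg hr0 (mul_pos hτ0 hM).le, sq_nonneg (τ * M), sq_nonneg r]
  have hghost : √(4 * Qb + 5 * M ^ 2) ≤ 9 / 20 * y := by
    refine Real.sqrt_le_iff.2 ⟨by positivity, ?_⟩
    rw [mul_pow, hy, Real.sq_sqrt (by positivity)]
    nlinarith [mul_le_mul_of_nonneg_right hτ hS0]
  have hsum : Sb + 2 * M + √(4 * Qb + 5 * M ^ 2) ≤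
      Sa + 147 / 40 * r + 49 / 8 * (τ * M) + 5 / 2 * M := by linarith
  have hτM : 25 * M ≤ τ * M := by nlinarith
  have hρM : 9 * (τ * M) ≤ ρ * M := by nlinarith
  suffices hSa : Sa + 147 / 40 * r ≤ 40 * (τ * M) by nlinarith
  by_cases hcase : (1 / (10 * M)) ^ 2 * Qa ≤ 2 * ρ
  · -- small second moment: the strongest admissible tilt
    have h3 := h0 (1 / (10 * M)) (by positivity) (by field_simp; exact le_rfl) hcase
    have h4 : 10 * (1 / (10 * M)) * Qa = r ^ 2 / (τ * M) := by rw [hr2]; field_simp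
    rw [h4] at h3
    have h5 : 147 / 40 * r ≤ r ^ 2 / (11 * (τ * M)) + 40 * (τ * M) := by
      have hTM : 0 < τ * M := by positivity
      rw [← sub_nonneg]
      have : r ^ 2 / (11 * (τ * M)) + 40 * (τ * M) - 147 / 40 * r =
          (r ^ 2 + 440 * (τ * M) ^ 2 - 147 / 40 * 11 * (τ * M) * r) / (11 * (τ * M)) := by
        field_simp
        ring
      rw [this]
      refine div_nonneg ?_ (by positivity)
      nlinarith [sq_nonneg (r - 147 / 80 * 11 * (τ * M)), sq_nonneg (τ * M)]
    have h6 : r ^ 2 / (11 * (τ * M)) = r ^ 2 / (τ * M) / 11 := by field_simp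
    linarith
  · -- large second moment: the tilt that exhausts the divergence budget
    rw [not_le] at hcase
    have hQpos : 0 < Qa := by
      rcases hQa.eq_or_lt with h | h
      · rw [← h] at hcase; linarith
      · exact h
    set l := √(2 * ρ / Qa) with hl
    have hl0 : 0 ≤ l := Real.sqrt_nonneg _
    have hl2 : l ^ 2 * Qa = 2 * ρ := by
      rw [hl, Real.sq_sqrt (div_nonneg (by linarith) hQa)]
      field_simp
    have hlM : 10 * l * M ≤ 1 := by
      have h3 : l ≤ 1 / (10 * M) := by
        refine le_of_sq_le_sq ?_ (by positivity)
        rw [← hl2] at hcase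
        exact (lt_of_mul_lt_mul_right hcase hQa).le
      rw [le_div_iff₀ (by positivity)] at h3
      linarith
    have h3 := h0 l hl0 hlM hl2.le
    have h4 : 147 / 40 * 11 * r ≤ 10 * l * Qa := by
      refine le_of_sq_le_sq ?_ (by positivity)
      have h5 : (10 * l * Qa) ^ 2 = 100 * (2 * ρ) * Qa := by rw [← hl2]; ring
      rw [h5, mul_pow, hr2]
      nlinarith [mul_le_mul_of_nonneg_right hρ hQa]
    nlinarith [mul_pos hτ0 hM]

/-! ### The deviation inequality -/

/-- For a fixed sequence of pairs, few exchanges produce a member of the class that has no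
positive weighted sum over the sample but a large sum over the ghost sample. -/
lemma card_swapCoords_bad_le {Z : Type*} {G : Set (Z → ℝ)} {M τ ρ : ℝ} {d n : ℕ} (hn : 0 < n)
    (hM : 0 < M) (hτ : 25 ≤ τ) (hρ : 9 * τ ≤ ρ) (hG : ∀ f ∈ G, ∀ x, |f x| ≤ M)
    (hd : vcDimFun G ≤ d) (w : Fin n → Z × Z) (T : Finset (Fin n → Bool))
    (hT : ∀ s ∈ T, ∃ f ∈ G,
      (∀ p ∈ uncertaintySet n ρ, ∑ i, p i * f (swapCoords s w i).1 ≤ 0) ∧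
      (50 * ρ / 3 + 4) * M < ∑ i, f (swapCoords s w i).2 + 2 * M +
        √(4 * ∑ i, f (swapCoords s w i).2 ^ 2 + 5 * M ^ 2)) :
    (T.card : ℝ) ≤ 2 * (16 * n ^ 2 + 1) ^ d * Real.exp (-τ) * 2 ^ n := by
  classical
  have hn' : (0 : ℝ) < n := by exact_mod_cast hn
  obtain ⟨H, hHG, hHcard, hH⟩ := exists_finset_net hM hG hd
    (fun q : Fin n × Bool => if q.2 then (w q.1).2 else (w q.1).1) (K := 8 * n) (by omega)
  have hε : 2 * M / ((8 * n : ℕ) : ℝ) = M / (4 * n) := by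
    push_cast; field_simp; norm_num
  -- the deviations of the first and of the second moment of a net function
  set v : ((Z → ℝ) × Bool) → Fin n → ℝ := fun k i =>
    if k.2 then k.1 (w i).2 ^ 2 - k.1 (w i).1 ^ 2 else k.1 (w i).2 - k.1 (w i).1 with hv
  set bad : ((Z → ℝ) × Bool) → Finset (Fin n → Bool) := fun k =>
    {s | √(2 * τ * ∑ i, v k i ^ 2) < ∑ i, if s i then -v k i else v k i} with hbad
  have hbad_card : ∀ k, ((bad k).card : ℝ) ≤ Real.exp (-τ) * 2 ^ n := fun k => by
    have h := card_sqrt_lt_signed_sum_le (v k) (by linarith : (0 : ℝ) ≤ τ)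
    rw [Fintype.card_fin] at h
    exact h
  have hcover : T ⊆ (H ×ˢ (Finset.univ : Finset Bool)).biUnion bad := by
    intro s hs
    obtain ⟨f, hf, hU, hlarge⟩ := hT s hs
    obtain ⟨g, hg, hfg⟩ := hH f hf
    rw [hε] at hfg
    have hfg1 : ∀ i, |f (swapCoords s w i).1 - g (swapCoords s w i).1| ≤ M / (4 * n) := by
      intro i
      by_cases hsi : s i
      · simpa [swapCoords, hsi] using hfg (i, true)
      · simpa [swapCoords, hsi] using hfg (i, false)
    have hfg2 : ∀ i, |f (swapCoords s w i).2 - g (swapCoords s w i).2| ≤ M / (4 * n) := by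
      intro i
      by_cases hsi : s i
      · simpa [swapCoords, hsi] using hfg (i, false)
      · simpa [swapCoords, hsi] using hfg (i, true)
    by_contra hnot
    have hgood : ∀ b, s ∉ bad (g, b) := fun b hb => hnot <|
      Finset.mem_biUnion.2 ⟨(g, b), Finset.mk_mem_product hg (Finset.mem_univ b), hb⟩
    have hsum : ∀ h : Z → ℝ, (∑ i, if s i then -(h (w i).2 - h (w i).1)
        else h (w i).2 - h (w i).1) = ∑ i, (h (swapCoords s w i).2 - h (swapCoords s w i).1) := by
      intro h
      refine Finset.sum_congr rfl fun i _ => ?_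
      by_cases hsi : s i <;> simp [swapCoords, hsi]
    have hsumsq : ∀ h : Z → ℝ, ∑ i, (h (w i).2 - h (w i).1) ^ 2 =
        ∑ i, (h (swapCoords s w i).2 - h (swapCoords s w i).1) ^ 2 := by
      intro h
      refine Finset.sum_congr rfl fun i _ => ?_
      by_cases hsi : s i <;> simp [swapCoords, hsi]
      ring
    have g1 := hgood false
    have g2 := hgood true
    simp only [hbad, hv, Finset.mem_filter, Finset.mem_univ, true_and, not_lt, if_true,
      Bool.false_eq_true, if_false] at g1 g2
    rw [hsum g, hsumsq g] at g1
    rw [hsum fun x => g x ^ 2, hsumsq fun x => g x ^ 2] at g2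
    obtain ⟨h1, h2⟩ := moment_bounds_of_close hM (by linarith) hn
      (fun i => hG f hf _) (fun i => hG f hf _) (fun i => hG g (hHG g hg) _)
      (fun i => hG g (hHG g hg) _) hfg1 hfg2 g1 g2
    refine absurd hlarge (not_lt.2 (ghost_sum_le hM hτ hρ
      (Finset.sum_nonneg fun i _ => sq_nonneg _) (Finset.sum_nonneg fun i _ => sq_nonneg _)
      (fun l hl hlM hlρ => ?_) h1 h2))
    exact sum_add_mul_sum_sq_nonpos hn (fun i => hG f hf _) hU hl hlM (by linarith) hlρ
  calc (T.card : ℝ) ≤ ((H ×ˢ (Finset.univ : Finset Bool)).biUnion bad).card := by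
        exact_mod_cast Finset.card_le_card hcover
    _ ≤ ∑ k ∈ H ×ˢ (Finset.univ : Finset Bool), ((bad k).card : ℝ) := by
        exact_mod_cast Finset.card_biUnion_le
    _ ≤ ∑ _k ∈ H ×ˢ (Finset.univ : Finset Bool), Real.exp (-τ) * 2 ^ n :=
        Finset.sum_le_sum fun k _ => hbad_card k
    _ = 2 * H.card * (Real.exp (-τ) * 2 ^ n) := by
        rw [Finset.sum_const, Finset.card_product, nsmul_eq_mul]
        simp
        ring
    _ ≤ 2 * (16 * n ^ 2 + 1) ^ d * (Real.exp (-τ) * 2 ^ n) := by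
        have : (H.card : ℝ) ≤ (16 * n ^ 2 + 1) ^ d := by
          have h3 : (H.card : ℝ) ≤ ((Fintype.card (Fin n × Bool) * (8 * n) + 1) ^ d : ℕ) := by
            exact_mod_cast hHcard
          refine h3.trans (le_of_eq ?_)
          simp only [Fintype.card_prod, Fintype.card_fin, Fintype.card_bool]
          push_cast
          ring
        gcongr
    _ = _ := by ring

/-- One ghost sample detects a large mean with probability at least `1 / 2`. -/
lemma half_le_measure_lt_ghost_sum {Z : Type*} [MeasurableSpace Z] (P : Measure Z)
    [IsProbabilityMeasure P] {n : ℕ} {f : Z → ℝ} {M C : ℝ} (hf : Measurable f) (hM : 0 < M)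
    (hfM : ∀ x, |f x| ≤ M) (hC : C < n * ∫ x, f x ∂P) :
    1 / 2 ≤ (Measure.pi fun _ : Fin n => P)
      {y | C < ∑ i, f (y i) + 2 * M + √(4 * ∑ i, f (y i) ^ 2 + 5 * M ^ 2)} := by
  set D := √(4 * (Fintype.card (Fin n) * ∫ x, f x ^ 2 ∂P) + M ^ 2) with hD
  refine (half_le_measure_sum_and_sum_sq (ι := Fin n) P hf hM hfM hD).trans
    (measure_mono fun y hy => ?_)
  obtain ⟨h1, h2⟩ := hy
  have hq0 : 0 ≤ Fintype.card (Fin n) * ∫ x, f x ^ 2 ∂P :=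
    mul_nonneg (Nat.cast_nonneg _) (integral_nonneg fun x => sq_nonneg _)
  have hD2 : D ^ 2 = 4 * (Fintype.card (Fin n) * ∫ x, f x ^ 2 ∂P) + M ^ 2 :=
    Real.sq_sqrt (by positivity)
  have h3 : D - 2 * M ≤ √(4 * ∑ i, f (y i) ^ 2 + 5 * M ^ 2) :=
    Real.le_sqrt_of_sq_le (by nlinarith)
  rw [Fintype.card_fin] at h1
  simp only [Set.mem_ofPred_eq]
  linarith

/-- A data-dependent member of a VC class for which no weights in the uncertainty set give a
positive weighted sum over the sample is unlikely to have a large mean. -/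
lemma measure_large_mean_le {Z : Type*} [MeasurableSpace Z] (P : Measure Z)
    [IsProbabilityMeasure P] {G : Set (Z → ℝ)} {M τ ρ : ℝ} {d n : ℕ} (hn : 0 < n)
    (hM : 0 < M) (hτ : 25 ≤ τ) (hρ : 9 * τ ≤ ρ) (hG : ∀ f ∈ G, ∀ x, |f x| ≤ M)
    (hGm : ∀ f ∈ G, Measurable f) (hd : vcDimFun G ≤ d) {f : (Fin n → Z) → Z → ℝ}
    (hfm : Measurable fun q : (Fin n → Z) × Z => f q.1 q.2)
    (hf : ∀ᵐ z ∂(Measure.pi fun _ : Fin n => P),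
      f z ∈ G ∧ ∀ p ∈ uncertaintySet n ρ, ∑ i, p i * f z (z i) ≤ 0) :
    (Measure.pi fun _ : Fin n => P)
      {z | (50 * ρ / 3 + 4) * M < n * ∫ x, f z x ∂P} ≤
      ENNReal.ofReal (4 * (16 * n ^ 2 + 1) ^ d * Real.exp (-τ)) := by
  classical
  set μ := Measure.pi fun _ : Fin n => P with hμ
  -- a measurable set of full measure on which the almost sure hypotheses hold
  obtain ⟨N, hN, hNm, hN0⟩ := exists_measurable_superset_of_null (ae_iff.1 hf)
  have hgood : ∀ z, z ∉ N → f z ∈ G ∧ ∀ p ∈ uncertaintySet n ρ, ∑ i, p i * f z (z i) ≤ 0 :=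
    fun z hz => by_contra fun h => hz (hN h)
  set B : Set (Fin n → Z) := Nᶜ ∩ {z | (50 * ρ / 3 + 4) * M < n * ∫ x, f z x ∂P} with hB
  have hBm : MeasurableSet B := by
    refine hNm.compl.inter (measurableSet_lt measurable_const (measurable_const.mul ?_))
    exact (hfm.stronglyMeasurable.integral_prod_right (f := fun z x => f z x)).measurable
  set C : Set ((Fin n → Z) × (Fin n → Z)) := {q | q.1 ∈ B ∧ (50 * ρ / 3 + 4) * M <
    ∑ i, f q.1 (q.2 i) + 2 * M + √(4 * ∑ i, f q.1 (q.2 i) ^ 2 + 5 * M ^ 2)} with hC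
  have hCm : MeasurableSet C := by
    have h1 : ∀ i, Measurable fun q : (Fin n → Z) × (Fin n → Z) => f q.1 (q.2 i) := fun i =>
      hfm.comp (measurable_fst.prodMk ((measurable_pi_apply i).comp measurable_snd))
    have h2 : Measurable fun q : (Fin n → Z) × (Fin n → Z) =>
        ∑ i, f q.1 (q.2 i) + 2 * M + √(4 * ∑ i, f q.1 (q.2 i) ^ 2 + 5 * M ^ 2) := by
      fun_prop
    exact (hBm.preimage measurable_fst).inter (measurableSet_lt measurable_const h2)
  have hghost : μ B ≤ 2 * μ.prod μ C := by
    refine measure_le_two_mul_prod μ μ hCm fun z hz => ?_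
    have hzG := (hgood z hz.1).1
    refine (half_le_measure_lt_ghost_sum P (hGm _ hzG) hM (hG _ hzG) hz.2).trans
      (measure_mono fun y hy => ⟨hz, hy⟩)
  have hmp := measurePreserving_arrowProdEquivProdArrow Z Z (Fin n) (fun _ => P) fun _ => P
  have hswap : μ.prod μ C ≤
      ENNReal.ofReal (2 * (16 * n ^ 2 + 1) ^ d * Real.exp (-τ)) := by
    rw [hμ, ← hmp.measure_preimage hCm.nullMeasurableSet]
    refine measure_le_of_card_swapCoords_le P (hmp.measurable hCm) fun w => ?_
    rw [Fintype.card_fin]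
    refine card_swapCoords_bad_le hn hM hτ hρ hG hd w _ fun s hs => ?_
    obtain ⟨hsB, hs⟩ := (Finset.mem_filter.1 hs).2
    exact ⟨_, (hgood _ hsB.1).1, (hgood _ hsB.1).2, hs⟩
  calc μ {z | (50 * ρ / 3 + 4) * M < n * ∫ x, f z x ∂P} ≤ μ (B ∪ N) := by
        refine measure_mono fun z hz => ?_
        by_cases hzN : z ∈ N
        · exact Or.inr hzN
        · exact Or.inl ⟨hzN, hz⟩
    _ ≤ μ B + μ N := measure_union_le _ _
    _ = μ B := by rw [hN0, add_zero]
    _ ≤ 2 * ENNReal.ofReal (2 * (16 * n ^ 2 + 1) ^ d * Real.exp (-τ)) := hghost.trans (by gcongr)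
    _ = _ := by
      rw [show (2 : ENNReal) = ENNReal.ofReal 2 by simp, ← ENNReal.ofReal_mul (by norm_num)]
      congr 1
      ring

/-! ### The DRRho risk -/

/-- The reference model has DRRho risk zero, so for a minimizer no weights in the uncertainty set
give a positive weighted sum of the losses. -/
lemma sum_mul_rhoLoss_nonpos_of_isMinOn {W Z : Type*} {ℓ : W → Z → ℝ} {Θ : Set W} {θref θ : W}
    {ρ M : ℝ} {n : ℕ} {z : Fin n → Z} (href : θref ∈ Θ) (hM : ∀ x, rhoLoss ℓ θref θ x ≤ M)
    (hθ : IsMinOn (drrhoRisk ℓ θref ρ z) Θ θ) {p : Fin n → ℝ} (hp : p ∈ uncertaintySet n ρ) :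
    ∑ i, p i * rhoLoss ℓ θref θ (z i) ≤ 0 := by
  have h1 : drrhoRisk ℓ θref ρ z θref ≤ 0 := by
    refine Real.sSup_nonpos ?_
    rintro _ ⟨p, -, rfl⟩
    simp [rhoLoss]
  have h2 : BddAbove ((fun p : Fin n → ℝ => ∑ i, p i * rhoLoss ℓ θref θ (z i)) ''
      uncertaintySet n ρ) := by
    refine ⟨M, ?_⟩
    rintro _ ⟨p, hp, rfl⟩
    calc ∑ i, p i * rhoLoss ℓ θref θ (z i) ≤ ∑ i, p i * M :=
          Finset.sum_le_sum fun i _ => mul_le_mul_of_nonneg_left (hM _) (hp.1.1 i)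
      _ = M := by rw [← Finset.sum_mul, hp.1.2, one_mul]
  exact (le_csSup h2 ⟨p, hp, rfl⟩).trans ((hθ href).trans h1)

/-! ### The exponent `C₁` -/

/-- The exponent `C₁` pays for the size of the net. -/
lemma four_mul_pow_mul_exp_neg_constC1_le {δ : ℝ} {d n : ℕ} (hδ : 0 < δ) (hn : 0 < n) :
    4 * (16 * n ^ 2 + 1) ^ d * Real.exp (-constC1 (Real.exp 25) δ d n) ≤ δ := by
  have hn' : (1 : ℝ) ≤ n := by exact_mod_cast hn
  have hn0 : (0 : ℝ) < n := by linarith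
  have he : (2 : ℝ) ≤ Real.exp 1 := by linarith [Real.add_one_le_exp 1]
  have h1 : Real.exp (constC1 (Real.exp 25) δ d n) =
      δ⁻¹ * Real.exp 25 * (16 * Real.exp 1 * n ^ 2) ^ d := by
    have h2 : constC1 (Real.exp 25) δ d n =
        Real.log (δ⁻¹ * Real.exp 25 * (16 * Real.exp 1 * n ^ 2) ^ d) := by
      rw [Real.log_mul (by positivity) (by positivity), Real.log_mul (by positivity)
        (by positivity), Real.log_pow, Real.log_mul (by positivity) (by positivity), Real.log_pow,
        constC1, one_div]
      push_cast
      ring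
    rw [h2, Real.exp_log (by positivity)]
  rw [Real.exp_neg, h1, ← div_eq_mul_inv, div_le_iff₀ (by positivity)]
  have h3 : ((16 : ℝ) * n ^ 2 + 1) ^ d ≤ (16 * Real.exp 1 * n ^ 2) ^ d := by
    gcongr
    nlinarith
  have h4 : (4 : ℝ) ≤ Real.exp 25 := by linarith [Real.add_one_le_exp (25 : ℝ)]
  calc 4 * ((16 : ℝ) * n ^ 2 + 1) ^ d ≤ Real.exp 25 * (16 * Real.exp 1 * n ^ 2) ^ d := by gcongr
    _ = _ := by field_simp

lemma le_constC1 {δ : ℝ} {d n : ℕ} (hδ : 0 < δ) (hδ1 : δ ≤ 1) (hn : 0 < n) :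
    25 ≤ constC1 (Real.exp 25) δ d n := by
  have hn' : (1 : ℝ) ≤ n := by exact_mod_cast hn
  have h1 : 0 ≤ Real.log (1 / δ) := Real.log_nonneg (by rw [le_div_iff₀ hδ]; linarith)
  have h2 : 0 ≤ Real.log (16 * Real.exp 1) :=
    Real.log_nonneg (by linarith [Real.add_one_le_exp (1 : ℝ)])
  have h3 : 0 ≤ Real.log n := Real.log_nonneg hn'
  rw [constC1, Real.log_exp]
  have h4 : 0 ≤ d * Real.log (16 * Real.exp 1) := by positivity
  have h5 : 0 ≤ 2 * d * Real.log n := by positivity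
  linarith

end DRRho

/-! ### The excess risk bound -/

theorem mainTheorem3 :
    ∃ c : ℝ, 0 < c ∧
      ∀ {W : Type*} {Z : Type*} [MeasurableSpace Z]
        (P : Measure Z) [IsProbabilityMeasure P]
        (ℓ : W → Z → ℝ) (Θ : Set W) (M₀ M₁ : ℝ)
        (θref θstar : W) (n d : ℕ) (δ ρ : ℝ)
        (θtilde : (Fin n → Z) → W),
        -- the loss is measurable and takes values in `[M₀, M₁]`
        (∀ θ ∈ Θ, Measurable (ℓ θ)) →
        (∀ θ ∈ Θ, ∀ x, ℓ θ x ∈ Set.Icc M₀ M₁) →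
        -- the reference model belongs to the family
        θref ∈ Θ →
        -- `θstar` minimizes the expected risk
        (θstar ∈ Θ ∧ IsMinOn (DRRho.risk P ℓ) Θ θstar) →
        -- the class of RHO losses has finite VC-dimension `d`
        DRRho.vcDimFun (DRRho.rhoClass ℓ Θ θref) = (d : ℕ∞) →
        0 < n →
        0 < δ →
        32 * (M₁ - M₀) ^ 2 ≤ DRRho.constC1 c δ d n * n →
        9 * DRRho.constC1 c δ d n ≤ ρ →
        -- for almost every sample, `θtilde z` minimizes the DRRho risk over `Θ`
        (∀ᵐ z ∂(Measure.pi fun _ : Fin n => P),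
          θtilde z ∈ Θ ∧ IsMinOn (DRRho.drrhoRisk ℓ θref ρ z) Θ (θtilde z)) →
        -- the loss of the learned model is a measurable function of sample and test point
        Measurable (fun q : (Fin n → Z) × Z => ℓ (θtilde q.1) q.2) →
        ENNReal.ofReal (1 - δ) ≤
          (Measure.pi fun _ : Fin n => P)
            {z | DRRho.risk P ℓ (θtilde z) - DRRho.risk P ℓ θstar ≤
              DRRho.risk P ℓ θref - DRRho.risk P ℓ θstar +
                DRRho.constC2 ρ (M₁ - M₀) / n} := by
  refine ⟨Real.exp 25, Real.exp_pos _, ?_⟩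
  intro W Z _ P _ ℓ Θ M₀ M₁ θref θstar n d δ ρ θtilde hmeas hbdd href _ hvc hn hδ _ hρ hmin hjoint
  rcases le_or_gt 1 δ with hδ1 | hδ1
  · rw [ENNReal.ofReal_of_nonpos (by linarith)]
    exact zero_le
  have hn' : (0 : ℝ) < n := by exact_mod_cast hn
  set μ := Measure.pi fun _ : Fin n => P with hμ
  set M := M₁ - M₀ with hM
  set τ := DRRho.constC1 (Real.exp 25) δ d n with hτ
  have hτ25 : 25 ≤ τ := DRRho.le_constC1 hδ hδ1.le hn
  have hbound : ∀ θ ∈ Θ, ∀ x, |DRRho.rhoLoss ℓ θref θ x| ≤ M := by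
    intro θ hθ x
    obtain ⟨h1, h2⟩ := hbdd θ hθ x
    obtain ⟨h3, h4⟩ := hbdd θref href x
    rw [DRRho.rhoLoss, abs_le]
    constructor <;> linarith
  have hrisk : ∀ θ ∈ Θ, DRRho.risk P ℓ θ - DRRho.risk P ℓ θref =
      ∫ x, DRRho.rhoLoss ℓ θref θ x ∂P := by
    have hint : ∀ θ ∈ Θ, Integrable (ℓ θ) P := fun θ hθ =>
      Integrable.of_mem_Icc M₀ M₁ (hmeas θ hθ).aemeasurable (.of_forall (hbdd θ hθ))
    intro θ hθ
    exact (integral_sub (hint θ hθ) (hint θref href)).symm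
  set Good : Set (Fin n → Z) := {z | DRRho.risk P ℓ (θtilde z) - DRRho.risk P ℓ θstar ≤
    DRRho.risk P ℓ θref - DRRho.risk P ℓ θstar + DRRho.constC2 ρ M / n} with hGood
  have hgood : ∀ z, θtilde z ∈ Θ →
      n * ∫ x, DRRho.rhoLoss ℓ θref (θtilde z) x ∂P ≤ (50 * ρ / 3 + 4) * M → z ∈ Good := by
    intro z hz hle
    rw [← hrisk _ hz, mul_comm, ← le_div_iff₀ hn'] at hle
    simp only [hGood, Set.mem_ofPred_eq, DRRho.constC2]
    linarith
  obtain ⟨x₀⟩ : Nonempty Z := nonempty_of_isProbabilityMeasure P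
  have hM0 : 0 ≤ M := (abs_nonneg _).trans (hbound θref href x₀)
  rcases hM0.eq_or_lt with hMz | hMpos
  · -- a constant loss
    have hae : Good =ᵐ[μ] Set.univ := by
      rw [Filter.eventuallyEq_univ]
      filter_upwards [hmin] with z hz
      refine hgood z hz.1 ?_
      have h0 : ∀ x, DRRho.rhoLoss ℓ θref (θtilde z) x = 0 := fun x =>
        abs_nonpos_iff.1 (hMz ▸ hbound _ hz.1 x)
      simp [h0, ← hMz]
    rw [measure_congr hae, measure_univ]
    exact ENNReal.ofReal_le_one.2 (by linarith)
  · have hbad := DRRho.measure_large_mean_le P (G := DRRho.rhoClass ℓ Θ θref) hn hMpos hτ25 hρ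
      (by rintro _ ⟨θ, hθ, rfl⟩; exact hbound θ hθ)
      (by rintro _ ⟨θ, hθ, rfl⟩; exact (hmeas θ hθ).sub (hmeas θref href))
      hvc.le (f := fun z => DRRho.rhoLoss ℓ θref (θtilde z))
      (hjoint.sub ((hmeas θref href).comp measurable_snd))
      (by
        filter_upwards [hmin] with z hz
        exact ⟨⟨_, hz.1, rfl⟩, fun p hp => DRRho.sum_mul_rhoLoss_nonpos_of_isMinOn href
          (fun x => (le_abs_self _).trans (hbound _ hz.1 x)) hz.2 hp⟩)
    have hbad' := hbad.trans
      (ENNReal.ofReal_le_ofReal (DRRho.four_mul_pow_mul_exp_neg_constC1_le hδ hn))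
    set Bad : Set (Fin n → Z) :=
      {z | (50 * ρ / 3 + 4) * M < n * ∫ x, DRRho.rhoLoss ℓ θref (θtilde z) x ∂P} with hBad
    have hcov : (Good ∪ Bad : Set _) =ᵐ[μ] Set.univ := by
      rw [Filter.eventuallyEq_univ]
      filter_upwards [hmin] with z hz
      by_cases h : (50 * ρ / 3 + 4) * M < n * ∫ x, DRRho.rhoLoss ℓ θref (θtilde z) x ∂P
      · exact Or.inr h
      · exact Or.inl (hgood z hz.1 (not_lt.1 h))
    have h1 : (1 : ENNReal) ≤ μ Good + ENNReal.ofReal δ := by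
      calc (1 : ENNReal) = μ (Good ∪ Bad) := by
            rw [measure_congr hcov, measure_univ]
        _ ≤ μ Good + μ Bad := measure_union_le _ _
        _ ≤ _ := by gcongr
    rw [ENNReal.ofReal_sub _ hδ.le, ENNReal.ofReal_one]
    exact tsub_le_iff_right.2 h1
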